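/- Let $n\ge 1$ be an integer and let $m\in\mathbb{R}$, $m\neq 0$. Write points of $\mathbb{R}^{1+n}$ in light-cone coordinates as $(x^+,x_\bot,x^-)$ with $x^+,x^-\in\mathbb{R}$ and $x_\bot=(x^1,\dots,x^{n-1})\in\mathbb{R}^{n-1}$, and put $\partial_\pm=\partial/\partial x^\pm$ and $\widetilde{\Box}=2\partial_+\partial_--\sum_{i=1}^{n-1}\partial_i^2$. Let $\mathcal S(\mathbb{R}^{1+n})$ be the space of complex-valued Schwartz functions and $\mathcal S'(\mathbb{R}^{1+n})$ its continuous dual, the space of tempered distributions. Let $$\mathcal S_{\partial_-}(\mathbb{R}^{1+n})=\bigcap_{k\ge 0}\partial_-^k\,\mathcal S(\mathbb{R}^{1+n})=\{g:\ \forall k\ge 0\ \exists h\in\mathcal S(\mathbb{R}^{1+n})\ \ g=\partial_-^k h\},$$ with the subspace topology induced by $\mathcal S(\mathbb{R}^{1+n})$, and let $\mathcal S'_{\partial_-}(\mathbb{R}^{1+n})$ be its continuous dual. The relaxation of $u\in\mathcal S'(\mathbb{R}^{1+n})$ is the restriction $u^*=u|_{\mathcal S_{\partial_-}(\mathbb{R}^{1+n})}\in\mathcal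 S'_{\partial_-}(\mathbb{R}^{1+n})$. Then for every $v\in\mathcal S'(\mathbb{R}^{1+n})$, any solution $u\in\mathcal S'(\mathbb{R}^{1+n})$ of the inhomogeneous light-cone Klein–Gordon equation $$(\widetilde{\Box}+m^2)u=v$$ is uniquely determined by its relaxation $u^*$: if $u_1,u_2\in\mathcal S'(\mathbb{R}^{1+n})$ satisfy $(\widetilde{\Box}+m^2)u_1=v=(\widetilde{\Box}+m^2)u_2$ and $u_1^*=u_2^*$, then $u_1=u_2$. -/

import Mathlib

open scoped SchwartzMap LineDeriv

/-- The coordinate space `ℝ^{1+n}` with light-cone coordinates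
`(x⁺, x_⊥, x⁻) = (x 0, (x 1, …, x (n-1)), x n)`. -/
abbrev LCSpace (n : ℕ) : Type := EuclideanSpace ℝ (Fin (n + 1))

namespace LCSpace

/-- The `i`-th standard basis vector of `ℝ^{1+n}`. -/
noncomputable def e {n : ℕ} (i : Fin (n + 1)) : LCSpace n := EuclideanSpace.single i (1 : ℝ)

/-- The direction of the coordinate `x⁺` (the first one). -/
noncomputable def ePlus (n : ℕ) : LCSpace n := e 0

/-- The direction of the coordinate `x⁻` (the last one). -/
noncomputable def eMinus (n : ℕ) : LCSpace n := e (Fin.last n)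

end LCSpace

open LCSpace

/-- The indices `1, …, n - 1` of the transversal coordinates `x_⊥`. -/
def transversal (n : ℕ) : Finset (Fin (n + 1)) :=
  Finset.univ.filter fun i => i ≠ 0 ∧ i ≠ Fin.last n

/-- The d'Alembert operator in light-cone coordinates on tempered distributions,
`2 ∂₊ ∂₋ u - ∑_{i=1}^{n-1} ∂ᵢ² u`, with distributional derivatives. -/
noncomputable def lcBox {n : ℕ} (u : 𝓢'(LCSpace n, ℂ)) : 𝓢'(LCSpace n, ℂ) :=
  (2 : ℂ) • ∂_{ePlus n} (∂_{eMinus n} u) - ∑ i ∈ transversal n, ∂_{e i} (∂_{e i} u)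

/-- `u` is a tempered solution of the inhomogeneous light-cone Klein-Gordon equation
`(lcBox + m²) u = v`. -/
def IsLCKGSolution {n : ℕ} (m : ℝ) (v u : 𝓢'(LCSpace n, ℂ)) : Prop :=
  lcBox u + ((m : ℂ) ^ 2) • u = v

/-- The space `⋂_{k ≥ 0} ∂₋^k 𝓢(ℝ^{1+n})`, a subspace of the Schwartz space `𝓢(ℝ^{1+n})`
(as a subtype it carries the subspace topology). -/
noncomputable def tameSchwartz (n : ℕ) : Submodule ℂ 𝓢(LCSpace n, ℂ) :=
  ⨅ k : ℕ, LinearMap.range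
    ((LineDeriv.lineDerivOpCLM ℂ 𝓢(LCSpace n, ℂ) (eMinus n)).toLinearMap ^ k)

theorem mem_tameSchwartz_iff {n : ℕ} (g : 𝓢(LCSpace n, ℂ)) :
    g ∈ tameSchwartz n ↔ ∀ k : ℕ, ∃ h : 𝓢(LCSpace n, ℂ), g = (∂_{eMinus n})^[k] h := by
  simp only [tameSchwartz, Submodule.mem_iInf, LinearMap.mem_range, Module.End.pow_apply]
  exact forall_congr' fun k => exists_congr fun h => eq_comm

/-- The space of tame generalized functions: the continuous dual of `tameSchwartz n`, with the
topology of pointwise convergence (the weak-* topology). -/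
abbrev TameDistribution (n : ℕ) : Type := (tameSchwartz n) →Lₚₜ[ℂ] ℂ

/-- The relaxation `u ↦ u*`: the pullback along the inclusion of `tameSchwartz n` in the
Schwartz space. -/
noncomputable def relaxation (n : ℕ) : 𝓢'(LCSpace n, ℂ) →L[ℂ] TameDistribution n :=
  PointwiseConvergenceCLM.precomp ℂ (tameSchwartz n).subtypeL

theorem relaxation_apply {n : ℕ} (u : 𝓢'(LCSpace n, ℂ)) (g : tameSchwartz n) :
    relaxation n u g = u (g : 𝓢(LCSpace n, ℂ)) := rfl

open Real
open scoped ContDiff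

/-! On the Fourier side the operator is multiplication by `lcSymbol`, `s = m² + 4π²|ξ_⊥|² - 8π² t`
with `t = ξ₊ ξ₋`. For small `|t|`, `s` is bounded below because `m ≠ 0`; for `|t|` away from zero,
`1/ξ₋ = ξ₊/t` is temperate. Cutting off in `t`, rather than in `ξ₋`, thus splits every test function
as `φ = Pψ + g`, where `P` has symbol `s` and `g` is divisible by every power of `ξ₋`, hence tame.
By `lcBox_add_apply`, `u φ = v ψ + u* g`. -/

/-- The inverse of a temperate function that is bounded below by a positive constant is
temperate. -/
theorem Function.HasTemperateGrowth.inv_of_le {E : Type*} [NormedAddCommGroup E]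
    [NormedSpace ℝ E] {f : E → ℝ} (hf : f.HasTemperateGrowth) {c : ℝ} (hc : 0 < c)
    (h : ∀ x, c ≤ f x) : (fun x => (f x)⁻¹).HasTemperateGrowth := by
  -- Halving `c` gives an open half-line that contains the range of `f` and on which every
  -- derivative of inversion is bounded.
  have hunique : UniqueDiffOn ℝ (Set.Ioi (c / 2)) := isOpen_Ioi.uniqueDiffOn
  have hpos : ∀ x ∈ Set.Ioi (c / 2), 0 < x := fun x hx => (half_pos hc).trans hx
  have hinv : ∀ x ∈ Set.Ioi (c / 2), ContDiffAt ℝ ∞ (Inv.inv : ℝ → ℝ) x :=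
    fun x hx => contDiffAt_inv ℝ (hpos x hx).ne'
  refine Function.HasTemperateGrowth.comp' (g := Inv.inv) (t := Set.Ioi (c / 2)) ?_ hunique
    (fun x hx => (hinv x hx).contDiffWithinAt) ?_ hf
  · rintro - ⟨x, rfl⟩
    exact (half_lt_self hc).trans_le (h x)
  · intro N
    -- The sum is one constant dominating the bounds for all orders up to `N`.
    refine ⟨0, ∑ k ∈ Finset.range (N + 1), (k.factorial : ℝ) * ((c / 2)⁻¹) ^ (k + 1),
      by positivity, fun n hn x hx => ?_⟩
    have hx0 := hpos x hx
    rw [norm_iteratedFDerivWithin_eq_norm_iteratedDerivWithin,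
      iteratedDerivWithin_eq_iteratedDeriv hunique ((hinv x hx).of_le (mod_cast le_top)) hx,
      iteratedDeriv_eq_iterate, iter_deriv_inv, pow_zero, mul_one]
    have hz : x ^ (-1 - n : ℤ) = x⁻¹ ^ (n + 1) := by
      rw [show (-1 - n : ℤ) = -((n + 1 : ℕ) : ℤ) by push_cast; ring, zpow_neg, zpow_natCast,
        inv_pow]
    calc ‖(-1) ^ n * (n.factorial : ℝ) * x ^ (-1 - n : ℤ)‖
        = (n.factorial : ℝ) * x⁻¹ ^ (n + 1) := by
          rw [hz, norm_mul, norm_mul, norm_pow, norm_neg, norm_one, one_pow, one_mul,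
            Real.norm_of_nonneg (by positivity), Real.norm_of_nonneg (by positivity)]
      _ ≤ (n.factorial : ℝ) * (c / 2)⁻¹ ^ (n + 1) := by
          have : c / 2 < x := hx
          gcongr
      _ ≤ _ := Finset.single_le_sum
          (f := fun k : ℕ => (k.factorial : ℝ) * (c / 2)⁻¹ ^ (k + 1))
          (fun _ _ => by positivity) (Finset.mem_range.2 (Nat.lt_succ_of_le hn))

/-- A smooth cutoff at scale `a`. -/
theorem exists_temperate_cutoff {a : ℝ} (ha : 0 < a) :
    ∃ χ : ℝ → ℝ, χ.HasTemperateGrowth ∧ (∀ t, 0 ≤ χ t) ∧ (∀ t, |t| ≤ a / 2 → χ t = 1) ∧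
      ∀ t, a ≤ |t| → χ t = 0 := by
  let b : ContDiffBump (0 : ℝ) := ⟨a / 2, a, half_pos ha, half_lt_self ha⟩
  refine ⟨b, b.hasCompactSupport.hasTemperateGrowth b.contDiff, fun t => b.nonneg,
    fun t ht => b.one_of_mem_closedBall ?_, fun t ht => b.zero_of_le_dist ?_⟩
  · simpa [Real.dist_eq] using ht
  · simpa [Real.dist_eq] using ht

/-- A smooth temperate function that agrees with `t ↦ t⁻¹` away from a neighbourhood of zero. -/
theorem exists_temperate_inv {c : ℝ} (hc : 0 < c) :
    ∃ F : ℝ → ℝ, F.HasTemperateGrowth ∧ ∀ t, c ≤ |t| → t * F t = 1 := by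
  obtain ⟨χ, hχ, hχ0, hχ1, hχc⟩ := exists_temperate_cutoff hc
  have hd : (fun t => t ^ 2 + χ t).HasTemperateGrowth := by fun_prop
  -- Near zero `χ = 1` gives the bound, elsewhere `t ^ 2` does.
  have hlow : ∀ t, min 1 ((c / 2) ^ 2) ≤ t ^ 2 + χ t := by
    intro t
    rcases le_total |t| (c / 2) with h | h
    · rw [hχ1 t h]
      exact (min_le_left _ _).trans (by nlinarith [sq_nonneg t])
    · refine (min_le_right _ _).trans ?_
      rw [← sq_abs t]
      have := hχ0 t
      nlinarith
  have hinv := hd.inv_of_le (by positivity) hlow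
  refine ⟨fun t => t * (t ^ 2 + χ t)⁻¹, by fun_prop, fun t ht => ?_⟩
  have : t ≠ 0 := abs_pos.1 (hc.trans_le ht)
  simp only [hχc t ht, add_zero]
  field_simp

namespace SchwartzMap

variable {E : Type*} [NormedAddCommGroup E] [InnerProductSpace ℝ E] [FiniteDimensional ℝ E]
  [MeasurableSpace E] [BorelSpace E]

theorem lineDerivOp_eq_fourierMultiplierCLM_complex (v : E) (f : 𝓢(E, ℂ)) :
    ∂_{v} f = fourierMultiplierCLM ℂ (fun ξ => 2 * π * Complex.I * (inner ℝ ξ v : ℝ)) f := by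
  have h : (fun ξ : E => ((inner ℝ ξ v : ℝ) : ℂ)).HasTemperateGrowth := by fun_prop
  rw [lineDeriv_eq_fourierMultiplierCLM, ← fourierMultiplierCLM_ofReal ℂ (by fun_prop)]
  exact congrArg (fun T => T f) (fourierMultiplierCLM_smul (F := ℂ) h (2 * π * Complex.I)).symm

theorem fourierMultiplierCLM_add {g₁ g₂ : E → ℂ} (hg₁ : g₁.HasTemperateGrowth)
    (hg₂ : g₂.HasTemperateGrowth) (f : 𝓢(E, ℂ)) :
    fourierMultiplierCLM ℂ g₁ f + fourierMultiplierCLM ℂ g₂ f =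
      fourierMultiplierCLM ℂ (g₁ + g₂) f := by
  simp only [fourierMultiplierCLM_apply, smulLeftCLM_add hg₁ hg₂, add_apply,
    FourierTransform.fourierInv_add]

theorem iterate_lineDerivOp_eq_fourierMultiplierCLM (v : E) (k : ℕ) (f : 𝓢(E, ℂ)) :
    (∂_{v})^[k] f =
      fourierMultiplierCLM ℂ (fun ξ => (2 * π * Complex.I * (inner ℝ ξ v : ℝ)) ^ k) f := by
  induction k with
  | zero => simp
  | succ k ih =>
    rw [Function.iterate_succ_apply', ih, lineDerivOp_eq_fourierMultiplierCLM_complex,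
      fourierMultiplierCLM_fourierMultiplierCLM_apply (by fun_prop) (by fun_prop)]
    congr 2
    ext ξ
    simp [pow_succ']

end SchwartzMap

open SchwartzMap

/-- The symbol of the light-cone Klein-Gordon operator. -/
noncomputable def lcSymbol (n : ℕ) (m : ℝ) (ξ : LCSpace n) : ℝ :=
  m ^ 2 + 4 * π ^ 2 * ∑ i ∈ transversal n, inner ℝ ξ (e i) ^ 2
    - 8 * π ^ 2 * (inner ℝ ξ (ePlus n) * inner ℝ ξ (eMinus n))

theorem hasTemperateGrowth_lcSymbol (n : ℕ) (m : ℝ) : (lcSymbol n m).HasTemperateGrowth := by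
  unfold lcSymbol
  fun_prop

/-- The light-cone Klein-Gordon operator acts on test functions as a Fourier multiplier. -/
theorem lcBox_add_apply {n : ℕ} (m : ℝ) (u : 𝓢'(LCSpace n, ℂ)) (ψ : 𝓢(LCSpace n, ℂ)) :
    (lcBox u + ((m : ℂ) ^ 2) • u) ψ =
      u (fourierMultiplierCLM ℂ (fun ξ => (lcSymbol n m ξ : ℂ)) ψ) := by
  have hsum : ∀ i : Fin (n + 1),
      (fun ξ : LCSpace n => -(4 * π ^ 2 * ((inner ℝ ξ (e i) : ℝ) : ℂ) ^ 2)).HasTemperateGrowth :=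
    fun i => by fun_prop
  have hsq : ∀ i : Fin (n + 1), ∂_{e i} (∂_{e i} ψ) =
      fourierMultiplierCLM ℂ (fun ξ => -(4 * π ^ 2 * ((inner ℝ ξ (e i) : ℝ) : ℂ) ^ 2)) ψ := by
    intro i
    simp only [lineDerivOp_eq_fourierMultiplierCLM_complex]
    rw [fourierMultiplierCLM_fourierMultiplierCLM_apply (by fun_prop) (by fun_prop)]
    congr 2
    ext ξ
    simp only [Pi.mul_apply]
    linear_combination (4 * π ^ 2 * ((inner ℝ ξ (e i) : ℝ) : ℂ) ^ 2) * Complex.I_sq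
  have hpm : ∂_{eMinus n} (∂_{ePlus n} ψ) = fourierMultiplierCLM ℂ (fun ξ =>
      -(4 * π ^ 2 * ((inner ℝ ξ (ePlus n) : ℝ) : ℂ) * ((inner ℝ ξ (eMinus n) : ℝ) : ℂ))) ψ := by
    simp only [lineDerivOp_eq_fourierMultiplierCLM_complex]
    rw [fourierMultiplierCLM_fourierMultiplierCLM_apply (by fun_prop) (by fun_prop)]
    congr 2
    ext ξ
    simp only [Pi.mul_apply]
    linear_combination (4 * π ^ 2 * ((inner ℝ ξ (ePlus n) : ℝ) : ℂ) *
      ((inner ℝ ξ (eMinus n) : ℝ) : ℂ)) * Complex.I_sq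
  have hL : fourierMultiplierCLM ℂ (fun ξ => (lcSymbol n m ξ : ℂ)) ψ =
      (2 : ℂ) • ∂_{eMinus n} (∂_{ePlus n} ψ) - ∑ i ∈ transversal n, ∂_{e i} (∂_{e i} ψ)
        + ((m : ℂ) ^ 2) • ψ := by
    have hS : (fun ξ : LCSpace n => ∑ i ∈ transversal n,
        -(4 * π ^ 2 * ((inner ℝ ξ (e i) : ℝ) : ℂ) ^ 2)).HasTemperateGrowth := by fun_prop
    have hsym : (fun ξ : LCSpace n => (lcSymbol n m ξ : ℂ)) =
        (2 : ℂ) • (fun ξ : LCSpace n =>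
          -(4 * π ^ 2 * ((inner ℝ ξ (ePlus n) : ℝ) : ℂ) * ((inner ℝ ξ (eMinus n) : ℝ) : ℂ)))
        + (-1 : ℂ) • (fun ξ : LCSpace n => ∑ i ∈ transversal n,
          -(4 * π ^ 2 * ((inner ℝ ξ (e i) : ℝ) : ℂ) ^ 2)) + fun _ => (m : ℂ) ^ 2 := by
      ext ξ
      simp only [lcSymbol, Pi.add_apply, Pi.smul_apply, smul_eq_mul, Finset.sum_neg_distrib,
        ← Finset.mul_sum]
      push_cast
      ring
    rw [hsym, ← fourierMultiplierCLM_add (by fun_prop) (by fun_prop),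
      ← fourierMultiplierCLM_add (by fun_prop) (by fun_prop),
      fourierMultiplierCLM_smul (by fun_prop), fourierMultiplierCLM_smul hS,
      fourierMultiplierCLM_sum ℂ fun i _ => hsum i, hpm]
    simp [hsq, sub_eq_add_neg]
  rw [hL]
  simp only [lcBox, map_add, map_sub, map_sum, map_smul]
  -- Each term has two derivatives, so the signs from duality cancel.
  simp [LineDeriv.lineDerivOp_neg]

theorem mainTheorem6 (n : ℕ) (hn : 1 ≤ n) (m : ℝ) (hm : m ≠ 0) (v : 𝓢'(LCSpace n, ℂ)) :
    Set.InjOn (fun u : 𝓢'(LCSpace n, ℂ) => relaxation n u)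
      {u : 𝓢'(LCSpace n, ℂ) | IsLCKGSolution m v u} := by
  intro u₁ h₁ u₂ h₂ hrel
  ext φ
  -- With this scale `a`, `|t| ≤ a` gives `8π² t ≤ m²/2`, so `s ≥ m²/2`.
  have ha : 0 < m ^ 2 / (16 * π ^ 2) := by positivity
  obtain ⟨χ, hχ, -, hχ1, hχ0⟩ := exists_temperate_cutoff ha
  obtain ⟨F, hF, hF1⟩ := exists_temperate_inv (c := m ^ 2 / 2) (by positivity)
  -- `G` must invert `t` down to `a/2`, since `1 - χ` is known to vanish only for `|t| ≤ a/2`.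
  obtain ⟨G, hG, hG1⟩ := exists_temperate_inv (half_pos ha)
  have hs : (lcSymbol n m).HasTemperateGrowth := hasTemperateGrowth_lcSymbol n m
  let t : LCSpace n → ℝ := fun ξ => inner ℝ ξ (ePlus n) * inner ℝ ξ (eMinus n)
  have ht : t.HasTemperateGrowth := by fun_prop
  have hχt : (fun ξ => χ (t ξ)).HasTemperateGrowth := hχ.comp ht
  have hGt : (fun ξ => G (t ξ)).HasTemperateGrowth := hG.comp ht
  have hFs : (fun ξ => F (lcSymbol n m ξ)).HasTemperateGrowth := hF.comp hs
  have hp : (fun ξ : LCSpace n => inner ℝ ξ (ePlus n)).HasTemperateGrowth := by fun_prop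
  let ψ := fourierMultiplierCLM ℂ (fun ξ => ((χ (t ξ) * F (lcSymbol n m ξ) : ℝ) : ℂ)) φ
  let g := fourierMultiplierCLM ℂ (fun ξ => ((1 - χ (t ξ) : ℝ) : ℂ)) φ
  have hdecomp : φ = fourierMultiplierCLM ℂ (fun ξ => (lcSymbol n m ξ : ℂ)) ψ + g := by
    have hone : φ = fourierMultiplierCLM ℂ (fun _ => (1 : ℂ)) φ := by simp
    simp only [ψ, g]
    rw [fourierMultiplierCLM_fourierMultiplierCLM_apply (by fun_prop) (by fun_prop),
      fourierMultiplierCLM_add (by fun_prop) (by fun_prop)]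
    conv_lhs => rw [hone]
    congr 2
    ext ξ
    simp only [Pi.add_apply, Pi.mul_apply]
    norm_cast
    rcases le_total (m ^ 2 / (16 * π ^ 2)) |t ξ| with h | h
    · simp [hχ0 _ h]
    · have hS : 0 ≤ ∑ i ∈ transversal n, inner ℝ ξ (e i) ^ 2 :=
        Finset.sum_nonneg fun _ _ => sq_nonneg _
      have hle : 8 * π ^ 2 * t ξ ≤ m ^ 2 / 2 := by
        have := mul_le_mul_of_nonneg_left ((le_abs_self _).trans h)
          (by positivity : (0 : ℝ) ≤ 8 * π ^ 2)
        refine this.trans_eq ?_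
        field_simp
        ring
      have hlow : m ^ 2 / 2 ≤ lcSymbol n m ξ := by
        have : 0 ≤ 4 * π ^ 2 * ∑ i ∈ transversal n, inner ℝ ξ (e i) ^ 2 := by positivity
        simp only [lcSymbol]
        linarith
      linear_combination (-χ (t ξ)) * hF1 _ (hlow.trans (le_abs_self _))
  have hg : g ∈ tameSchwartz n := by
    rw [mem_tameSchwartz_iff]
    intro k
    have hGk : (fun ξ => (((inner ℝ ξ (ePlus n) * G (t ξ)) ^ k * (1 - χ (t ξ)) : ℝ) : ℂ)
        / (2 * π * Complex.I) ^ k).HasTemperateGrowth := by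
      simp only [div_eq_mul_inv]
      fun_prop
    -- On the support of `1 - χ(t)`, `ξ₊ G(t)` equals `1/ξ₋`, so this is `g` divided by the symbol
    -- of `∂₋^k`.
    refine ⟨fourierMultiplierCLM ℂ (fun ξ => (((inner ℝ ξ (ePlus n) * G (t ξ)) ^ k *
      (1 - χ (t ξ)) : ℝ) : ℂ) / (2 * π * Complex.I) ^ k) φ, ?_⟩
    rw [iterate_lineDerivOp_eq_fourierMultiplierCLM,
      fourierMultiplierCLM_fourierMultiplierCLM_apply (by fun_prop) hGk]
    simp only [g]
    congr 2
    ext ξ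
    simp only [Pi.mul_apply]
    have hI : (2 * π * Complex.I) ≠ 0 := Complex.two_pi_I_ne_zero
    rw [mul_pow, mul_div_assoc', mul_assoc, mul_div_cancel_left₀ _ (pow_ne_zero k hI)]
    norm_cast
    rcases le_total |t ξ| (m ^ 2 / (16 * π ^ 2) / 2) with h | h
    · simp [hχ1 _ h]
    · rw [← mul_assoc, ← mul_pow, show inner ℝ ξ (eMinus n) * (inner ℝ ξ (ePlus n) * G (t ξ))
        = t ξ * G (t ξ) by simp only [t]; ring, hG1 _ h, one_pow, one_mul]
  have hψ : u₁ (fourierMultiplierCLM ℂ (fun ξ => (lcSymbol n m ξ : ℂ)) ψ) =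
      u₂ (fourierMultiplierCLM ℂ (fun ξ => (lcSymbol n m ξ : ℂ)) ψ) := by
    rw [← lcBox_add_apply, ← lcBox_add_apply]
    exact congrArg (fun w : 𝓢'(LCSpace n, ℂ) => w ψ) (Eq.trans h₁ (Eq.symm h₂))
  have hgu : u₁ g = u₂ g := congrArg (fun w : TameDistribution n => w ⟨g, hg⟩) hrel
  rw [hdecomp, map_add, map_add, hψ, hgu]
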